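/- Let $K$ be a number field of degree $d=[K:\mathbb{Q}]$. For a non-zero polynomial $F\in K[T]$ let $H(F)=\prod_v \|F\|_v^{d_v/d}$ be its absolute homogeneous height, where $v$ runs over all places of $K$, $d_v$ is the local degree at $v$, and $\|F\|_v$ is the largest $v$-adic absolute value of the coefficients of $F$, the absolute value $|\cdot|_v$ being normalized so that it extends the usual or the $p$-adic absolute value of $\mathbb{Q}$ (with $|p|_v=p^{-1}$). Let $M\ge 2$ and $n\ge 1$ be integers, let $A$ be a non-empty set of prime numbers $p$ with $M/2\le p\le M$, let $P\in K[T]$ be a non-zero polynomial of degree at most $n$, none of whose roots in an algebraic closure of $K$ is $0$ or a root of unity, and let $Q\in K[T]$ be a greatest common divisor of the polynomials $P(T^a)$ with $a\in A$. Suppose that $\ell$ is an integer with $$4\le 2\ell\le |A| \quad\text{and}\quad n\le \frac{1}{2^{\ell+1}(\ell+1)!}\binom{|A|}{\ell+2}.$$ Then $$\deg Q\le \frac{6\ell}{|A|}\deg P \quad\text{and}\quad \log H(Q)\le \frac{\ell\,2^{2\ell+6}}{|A|\,M}\bigl(M\deg P+\log H(P)\bigr).$$ -/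

import Mathlib

open Polynomial

/-- The absolute homogeneous height of a polynomial over a number field `K` of degree `d` over `ℚ`:
the product over all places `v` of `K` of `‖P‖_v ^ (d_v / d)`, where `‖P‖_v` is the maximum of the
`v`-adic absolute values of the coefficients of `P` and `d_v` is the local degree.
Mathlib's `Height.mulHeight` is the product of the `‖P‖_v ^ d_v`: each infinite place is counted
with its multiplicity, and Mathlib's absolute value at a finite place is the `d_v`-th power of the
one that extends the `p`-adic absolute value of `ℚ`. Coefficients outside the support vanish, so
they do not contribute to the maxima. -/
noncomputable def polyHeight {K : Type*} [Field K] [NumberField K] (P : K[X]) : ℝ :=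
  Height.mulHeight (fun i : P.support ↦ P.coeff i) ^ (1 / (Module.finrank ℚ K : ℝ))

/-- `Q` is a greatest common divisor in `K[T]` of the polynomials `P(T ^ a)` with `a ∈ A`. -/
def IsGcdOfPowers {K : Type*} [Field K] (A : Finset ℕ) (P Q : K[X]) : Prop :=
  (∀ a ∈ A, Q ∣ P.comp (X ^ a)) ∧ ∀ R : K[X], (∀ a ∈ A, R ∣ P.comp (X ^ a)) → R ∣ Q

/-!
Let `L` be a number field in which `P` and `Q` split, let `T` and `S` be the sets of roots of `Q`
and of `P` in `L`. If `x ∈ T` then `x ^ a ∈ S` for every `a ∈ A`, and since `T ^ a - x ^ a` has a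
simple zero at `x`, the multiplicity of `x` in `Q` is at most that of `x ^ a` in `P`. So everything
takes place in the bipartite graph with an edge from `x` to `x ^ a` for all `x ∈ T` and `a ∈ A`.

**Growth.** Suppose that in some nonempty subgraph each left vertex has more than `#A / 2` edges and
each right vertex more than `3 ℓ`. Fix a left vertex `β`. It is not a torsion element, so the vertices
that can be reached from it carry, for each prime `p ∈ A`, an exponent relative to `β`. Call an edge
`(x, a)` forward if `x` is a power of `β` with `a`-integral exponent, up to torsion of order prime to
`a` (`IsLocalPow`). After `k` steps in each direction, at most `k` primes divide the exponent and at
most `k` primes violate `IsLocalPow`. Hence a left vertex has at most `k` edges that are not forward,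
a right vertex at most `k + 1` that are, and these are also bounds for the number of edges that
collide in one vertex. Torsion does no harm: among the `p`-th roots of an element at most one is a
local power of `β` at `p` (`IsLocalPow.eq_of_pow_eq`). Alternating forward and backward steps gives
at least `(#A / 2 + 1).choose (ℓ + 2) * (3 * ℓ).choose (ℓ + 1)` vertices on the right
(`choose_mul_choose_le_card_image_pow`), which exceeds `n` (`lt_choose_mul_choose`).

**Removing stars.** Therefore each nonempty subgraph has a left vertex of degree at most `#A / 2` or a
right vertex of degree at most `3 ℓ`. Removing such vertices one at a time bounds every weighted sum
over the edges (`sum_le_of_forall_exists_small_fiber`), and for weights `w` on `T` and `v` on `S` with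
`w x ≤ v (x ^ a)` it follows that `#A * ∑ w ≤ 6 * ℓ * ∑ v` (`card_mul_sum_le_of_pow_mem`).

**Conclusion.** Multiplicities as weights give the bound for the degree. For the height, `x` gets the
weight multiplicity times `h(x)`, and a root `s` of `P` gets multiplicity times `(2 / M) h(s)`, as
`h(x ^ a) = a h(x) ≥ (M / 2) h(x)`. The sum of the heights of the roots of a polynomial differs from
the logarithm of its height by at most `log 2` times the degree
(`abs_log_mulHeight_sub_sum_logHeight₁_le`), and heights over `K` and over `L` are related by
`mulHeight_algebraMap`.
-/

/-! ### Heights and field extensions -/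

open NumberField in
theorem prod_infinitePlace_pow_mult {L : Type*} [Field L] [NumberField L]
    (f : InfinitePlace L → ℝ) :
    ∏ w, f w ^ w.mult = ∏ φ : L →+* ℂ, f (InfinitePlace.mk φ) := by
  classical
  rw [← Finset.prod_fiberwise Finset.univ (fun φ : L →+* ℂ ↦ InfinitePlace.mk φ)]
  refine Finset.prod_congr rfl fun w _ ↦ ?_
  rw [Finset.prod_congr rfl (g := fun _ ↦ f w) (by simp +contextual),
    Finset.prod_const, InfinitePlace.card_filter_mk_eq]

open NumberField Module in
/-- Each complex embedding of `K` has `[L : K]` extensions to `L`. -/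
theorem card_filter_comp_algebraMap_eq {K L : Type*} [Field K] [Field L] [NumberField K]
    [NumberField L] [Algebra K L] (σ : K →+* ℂ)
    [DecidablePred fun φ : L →+* ℂ ↦ φ.comp (algebraMap K L) = σ] :
    (Finset.univ.filter fun φ : L →+* ℂ ↦ φ.comp (algebraMap K L) = σ).card = finrank K L := by
  let _ := σ.toAlgebra
  rw [← AlgHom.card K L ℂ, ← Finset.card_univ]
  symm
  refine Finset.card_bij (fun φ _ ↦ (φ : L →ₐ[K] ℂ).toRingHom) ?_ ?_ ?_
  · intro φ _
    simp only [Finset.mem_filter, Finset.mem_univ, true_and]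
    ext x
    exact φ.commutes x
  · intro φ _ ψ _ h
    ext x
    exact congrArg (fun g : L →+* ℂ ↦ g x) h
  · intro φ hφ
    simp only [Finset.mem_filter, Finset.mem_univ, true_and] at hφ
    refine ⟨{ φ with commutes' := fun x ↦ ?_ }, Finset.mem_univ _, ?_⟩
    · exact congrArg (fun g : K →+* ℂ ↦ g x) hφ
    · rfl

open NumberField Module in
theorem prod_infinitePlace_comap {K L : Type*} [Field K] [Field L] [NumberField K]
    [NumberField L] [Algebra K L] (f : InfinitePlace K → ℝ) :
    ∏ w : InfinitePlace L, f (w.comap (algebraMap K L)) ^ w.mult =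
      (∏ v, f v ^ v.mult) ^ finrank K L := by
  classical
  rw [prod_infinitePlace_pow_mult, prod_infinitePlace_pow_mult,
    ← Finset.prod_fiberwise Finset.univ (fun φ : L →+* ℂ ↦ φ.comp (algebraMap K L)),
    ← Finset.prod_pow]
  refine Finset.prod_congr rfl fun σ _ ↦ ?_
  rw [Finset.prod_congr rfl (g := fun _ ↦ f (InfinitePlace.mk σ)), Finset.prod_const,
    card_filter_comp_algebraMap_eq]
  intro φ hφ
  simp only [Finset.mem_filter, Finset.mem_univ, true_and] at hφ
  rw [InfinitePlace.comap_mk, hφ]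

open NumberField Height Module in
/-- The height of a tuple over `L` is the `[L : K]`-th power of its height over `K`. The finite part of
the height of an integral tuple is the inverse of the norm of the ideal that it generates, so the
finite places need only the norm of an extended ideal. -/
theorem mulHeight_algebraMap {K L : Type*} [Field K] [Field L] [NumberField K]
    [NumberField L] [Algebra K L] {ι : Type*} [Finite ι] (x : ι → K) :
    mulHeight (fun i ↦ algebraMap K L (x i)) = mulHeight x ^ finrank K L := by
  have : Fintype ι := Fintype.ofFinite ι
  rcases eq_or_ne x 0 with rfl | hx
  · have : (fun i : ι ↦ algebraMap K L ((0 : ι → K) i)) = 0 := by ext; simp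
    rw [this]; simp
  -- clear denominators
  obtain ⟨b, hb⟩ := IsLocalization.exist_integer_multiples_of_finite (nonZeroDivisors (𝓞 K)) x
  choose y hy using hb
  have hb0 : (b : 𝓞 K) ≠ 0 := nonZeroDivisors.coe_ne_zero b
  have hbK : algebraMap (𝓞 K) K b ≠ 0 := by simp
  have hyx : (fun i ↦ (y i : K)) = (algebraMap (𝓞 K) K b) • x := by
    ext i; simpa [Algebra.smul_def] using hy i
  have hy0 : y ≠ 0 := by
    rintro rfl
    apply smul_ne_zero hbK hx
    rw [← hyx]; ext; simp
  have hyK : (fun i ↦ (y i : K)) ≠ 0 := by rw [hyx]; exact smul_ne_zero hbK hx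
  let z : ι → 𝓞 L := fun i ↦ algebraMap (𝓞 K) (𝓞 L) (y i)
  have hzy : ∀ i, ((z i : 𝓞 L) : L) = algebraMap K L (y i) := fun i ↦ rfl
  have hz0 : z ≠ 0 := by
    obtain ⟨i, hi⟩ := Function.ne_iff.mp hyK
    refine Function.ne_iff.mpr ⟨i, fun h ↦ hi ?_⟩
    have := congrArg (fun t : 𝓞 L ↦ (t : L)) h
    simpa [hzy] using this
  have hzL : (fun i ↦ (z i : L)) ≠ 0 := by
    obtain ⟨i, hi⟩ := Function.ne_iff.mp hz0
    exact Function.ne_iff.mpr ⟨i, by simpa using hi⟩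
  have hzx : (fun i ↦ (z i : L)) =
      (algebraMap K L (algebraMap (𝓞 K) K b)) • (fun i ↦ algebraMap K L (x i)) := by
    ext i
    have := congrFun hyx i
    simp only [hzy, this, Pi.smul_apply, smul_eq_mul, map_mul]
  rw [← mulHeight_smul_eq_mulHeight x hbK, ← hyx,
    ← mulHeight_smul_eq_mulHeight (fun i ↦ algebraMap K L (x i))
      (c := algebraMap K L (algebraMap (𝓞 K) K b)) (by simp), ← hzx,
    NumberField.mulHeight_eq hyK, NumberField.mulHeight_eq hzL, mul_pow,
    ← prod_infinitePlace_comap]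
  congr 1
  have h1 := absNorm_mul_finprod_finitePlace_eq_one hy0
  have h2 := absNorm_mul_finprod_finitePlace_eq_one hz0
  have h3 : (Ideal.span (Set.range z)) =
      (Ideal.span (Set.range y)).map (algebraMap (𝓞 K) (𝓞 L)) := by
    rw [Ideal.map_span, ← Set.range_comp]; rfl
  rw [h3, Ideal.absNorm_algebraMap, Nat.cast_pow] at h2
  have h4 : finrank (𝓞 K) (𝓞 L) = finrank K L :=
    (IsFractionRing.finrank_eq (𝓞 K) K (𝓞 L) L).symm
  rw [h4] at h2
  have h5 := congrArg (· ^ finrank K L) h1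
  simp only [mul_pow, one_pow] at h5
  have h6 : (((Ideal.span (Set.range y)).absNorm : ℝ) ^ finrank K L) ≠ 0 :=
    left_ne_zero_of_mul (h5.trans_ne one_ne_zero)
  exact mul_left_cancel₀ h6 (h2.trans h5.symm)

/-! ### Heights of polynomials and of their roots -/

theorem gaussNorm_X_sub_C {R : Type*} [Field R] (v : AbsoluteValue R ℝ) (a : R) :
    (X - C a).gaussNorm v 1 = max (v a) 1 := by
  apply le_antisymm
  · obtain ⟨i, hi⟩ := exists_eq_gaussNorm v 1 (X - C a)
    rw [hi, one_pow, mul_one]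
    match i with
    | 0 => simp
    | 1 => simp
    | (i + 2) => simp [coeff_X]
  · have h (i : ℕ) : v ((X - C a).coeff i) * 1 ^ i ≤ _ := le_gaussNorm v (X - C a) zero_le_one i
    have h0 := h 0
    have h1 := h 1
    rw [coeff_sub, coeff_X_zero, coeff_C_zero, zero_sub, v.map_neg, one_pow, mul_one] at h0
    rw [coeff_sub, coeff_X_one, coeff_C_succ, sub_zero, v.map_one, one_pow, mul_one] at h1
    exact max_le h0 h1

/-- **Gauss's lemma** for a split polynomial: at a nonarchimedean absolute value the Gauss norm
plays the part of the Mahler measure. -/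
theorem gaussNorm_eq_of_splits {R : Type*} [Field R] {v : AbsoluteValue R ℝ}
    (hv : IsNonarchimedean v) {F : R[X]} (hF : F.Splits) :
    F.gaussNorm v 1 = v F.leadingCoeff * (F.roots.map fun a ↦ max (v a) 1).prod := by
  have key : ∀ s : Multiset R, ((s.map fun a ↦ X - C a).prod).gaussNorm v 1 =
      (s.map fun a ↦ max (v a) 1).prod := by
    intro s
    induction s using Multiset.induction with
    | empty => simpa using gaussNorm_C v 1 (1 : R)
    | cons a s ih =>
      simp only [Multiset.map_cons, Multiset.prod_cons]
      rw [gaussNorm_mul hv one_pos, ih, gaussNorm_X_sub_C]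
  conv_lhs => rw [hF.eq_prod_roots]
  rw [gaussNorm_mul hv one_pos, key, gaussNorm_C]

theorem iSup_support_eq_gaussNorm {R : Type*} [Field R] (v : AbsoluteValue R ℝ) {F : R[X]}
    (hF : F ≠ 0) : ⨆ i : F.support, v (F.coeff i) = F.gaussNorm v 1 := by
  have hne : F.support.Nonempty := support_nonempty.mpr hF
  have : Nonempty F.support := hne.to_subtype
  apply le_antisymm
  · exact ciSup_le fun i ↦ by simpa using le_gaussNorm v F zero_le_one i
  · obtain ⟨i, hi⟩ := exists_eq_gaussNorm v 1 F
    rw [hi, one_pow, mul_one]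
    by_cases hi0 : F.coeff i = 0
    · rw [hi0, map_zero]
      exact Real.iSup_nonneg fun _ ↦ v.nonneg _
    · exact Finite.le_ciSup (fun i : F.support ↦ v (F.coeff i)) ⟨i, mem_support_iff.mpr hi0⟩

open NumberField in
theorem iSup_support_eq_supNorm {L : Type*} [Field L] (v : InfinitePlace L) {F : L[X]}
    (hF : F ≠ 0) : ⨆ i : F.support, v (F.coeff i) = (F.map v.embedding).supNorm := by
  have hne : F.support.Nonempty := support_nonempty.mpr hF
  have : Nonempty F.support := hne.to_subtype
  apply le_antisymm
  · exact ciSup_le fun i ↦ by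
      simpa [InfinitePlace.norm_embedding_eq] using le_supNorm (F.map v.embedding) i
  · obtain ⟨i, hi⟩ := exists_eq_supNorm (F.map v.embedding)
    rw [hi, coeff_map, InfinitePlace.norm_embedding_eq]
    by_cases hi0 : F.coeff i = 0
    · rw [hi0, map_zero]
      exact Real.iSup_nonneg fun _ ↦ apply_nonneg v _
    · exact Finite.le_ciSup (fun i : F.support ↦ v (F.coeff i)) ⟨i, mem_support_iff.mpr hi0⟩

open NumberField in
theorem mahlerMeasure_map_embedding_of_splits {L : Type*} [Field L] (v : InfinitePlace L)
    {F : L[X]} (hF : F.Splits) :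
    (F.map v.embedding).mahlerMeasure =
      v F.leadingCoeff * (F.roots.map fun a ↦ max (v a) 1).prod := by
  rw [mahlerMeasure_eq_leadingCoeff_mul_prod_roots, hF.roots_map, leadingCoeff_map,
    InfinitePlace.norm_embedding_eq, Multiset.map_map]
  simp only [Function.comp_def, InfinitePlace.norm_embedding_eq, max_comm]

theorem supNorm_le_two_pow_mul_mahlerMeasure (p : ℂ[X]) :
    p.supNorm ≤ 2 ^ p.natDegree * p.mahlerMeasure := by
  refine p.supNorm_le_choose_natDegree_div_two_mul_mahlerMeasure.trans ?_
  gcongr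
  · exact p.mahlerMeasure_nonneg
  · exact_mod_cast Nat.choose_le_two_pow _ _

theorem mahlerMeasure_le_two_pow_mul_supNorm (p : ℂ[X]) :
    p.mahlerMeasure ≤ 2 ^ p.natDegree * p.supNorm := by
  refine p.mahlerMeasure_le_sqrt_natDegree_add_one_mul_supNorm.trans ?_
  gcongr
  · exact p.supNorm_nonneg
  · have h : ((p.natDegree : ℝ) + 1) ≤ 2 ^ p.natDegree := by
      exact_mod_cast Nat.lt_two_pow_self
    have h1 : (1 : ℝ) ≤ 2 ^ p.natDegree := one_le_pow₀ (by norm_num)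
    exact Real.sqrt_le_iff.mpr ⟨by positivity, h.trans (le_self_pow₀ h1 two_ne_zero)⟩

open NumberField in
theorem hasFiniteMulSupport_prod_max {L : Type*} [Field L] [NumberField L] (s : Multiset L) :
    Function.HasFiniteMulSupport
      fun v : FinitePlace L ↦ (s.map fun a ↦ max (v a) 1).prod := by
  induction s using Multiset.induction with
  | empty => simp [Function.HasFiniteMulSupport]
  | cons a s ih =>
    simp only [Multiset.map_cons, Multiset.prod_cons]
    refine Function.HasFiniteMulSupport.mul ?_ ih
    rcases eq_or_ne a 0 with rfl | ha
    · simp [Function.HasFiniteMulSupport]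
    · exact (FinitePlace.hasFiniteMulSupport ha).fun_comp (g := fun t ↦ max t 1) (max_self 1)

open NumberField Height in
theorem prod_mulHeight₁ {L : Type*} [Field L] [NumberField L] (s : Multiset L) :
    (s.map mulHeight₁).prod =
      (∏ v : InfinitePlace L, (s.map fun a ↦ max (v a) 1).prod ^ v.mult) *
        ∏ᶠ v : FinitePlace L, (s.map fun a ↦ max (v a) 1).prod := by
  induction s using Multiset.induction with
  | empty => simp
  | cons a s ih =>
    simp only [Multiset.map_cons, Multiset.prod_cons, mul_pow, Finset.prod_mul_distrib]
    have ha := hasFiniteMulSupport_prod_max {a}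
    simp only [Multiset.map_singleton, Multiset.prod_singleton] at ha
    rw [finprod_mul_distrib ha (hasFiniteMulSupport_prod_max s), ih, NumberField.mulHeight₁_eq]
    ring

open NumberField Height Module in
/-- The height of a polynomial and the product of the heights of its roots are comparable: they
agree at the finite places, and at each infinite place the sup norm and the Mahler measure differ
by a factor of at most `2 ^ deg`. The leading coefficient drops out by the product formula. -/
theorem abs_log_mulHeight_sub_sum_logHeight₁_le {L : Type*} [Field L] [NumberField L] {F : L[X]}
    (hF0 : F ≠ 0) (hF : F.Splits) :
    |Real.log (mulHeight fun i : F.support ↦ F.coeff i) - (F.roots.map logHeight₁).sum| ≤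
      finrank ℚ L * F.natDegree * Real.log 2 := by
  have hx0 : (fun i : F.support ↦ F.coeff i) ≠ 0 := by
    obtain ⟨i, hi⟩ := support_nonempty.mpr hF0
    exact Function.ne_iff.mpr ⟨⟨i, hi⟩, mem_support_iff.mp hi⟩
  have hlc : F.leadingCoeff ≠ 0 := leadingCoeff_ne_zero.mpr hF0
  set Z : ℝ := (F.roots.map mulHeight₁).prod with hZ
  set N : InfinitePlace L → ℝ := fun v ↦ (F.map v.embedding).supNorm with hN
  set B : InfinitePlace L → ℝ := fun v ↦ (F.map v.embedding).mahlerMeasure with hB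
  set f : ℝ := ∏ᶠ v : FinitePlace L, ⨆ i : F.support, v (F.coeff i) with hf
  have hZpos : 0 < Z := Multiset.prod_pos fun x hx ↦ by
    obtain ⟨a, -, rfl⟩ := Multiset.mem_map.mp hx
    exact mulHeight₁_pos a
  have hH : mulHeight (fun i : F.support ↦ F.coeff i) = (∏ v, N v ^ v.mult) * f := by
    rw [NumberField.mulHeight_eq hx0]
    simp only [hN, iSup_support_eq_supNorm _ hF0]
    rfl
  have hfin : f = (∏ᶠ v : FinitePlace L, v F.leadingCoeff) *
      ∏ᶠ v : FinitePlace L, (F.roots.map fun a ↦ max (v a) 1).prod := by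
    rw [← finprod_mul_distrib (FinitePlace.hasFiniteMulSupport hlc)
      (hasFiniteMulSupport_prod_max _), hf]
    refine finprod_congr fun v ↦ ?_
    have hv : IsNonarchimedean v.val := FinitePlace.add_le v
    exact (iSup_support_eq_gaussNorm v.val hF0).trans (gaussNorm_eq_of_splits hv hF)
  have hZ' : Z = (∏ v, B v ^ v.mult) * f := by
    have h1 : ∏ v, B v ^ v.mult = (∏ v : InfinitePlace L, v F.leadingCoeff ^ v.mult) *
        ∏ v : InfinitePlace L, (F.roots.map fun a ↦ max (v a) 1).prod ^ v.mult := by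
      simp only [hB, mahlerMeasure_map_embedding_of_splits _ hF, mul_pow, Finset.prod_mul_distrib]
    rw [h1, hfin, mul_mul_mul_comm, prod_abs_eq_one hlc, one_mul, hZ, prod_mulHeight₁]
  have hBpos : ∀ v, 0 < B v := fun v ↦
    mahlerMeasure_pos_of_ne_zero ((Polynomial.map_ne_zero_iff v.embedding.injective).mpr hF0)
  have hpow : ∀ g h : InfinitePlace L → ℝ, (∀ v, 0 ≤ g v) →
      (∀ v, g v ≤ 2 ^ F.natDegree * h v) →
      ∏ v, g v ^ v.mult ≤ 2 ^ (finrank ℚ L * F.natDegree) * ∏ v, h v ^ v.mult := by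
    intro g h hg hgh
    calc ∏ v, g v ^ v.mult ≤ ∏ v, (2 ^ F.natDegree * h v) ^ v.mult := by
          refine Finset.prod_le_prod (fun v _ ↦ pow_nonneg (hg v) _) fun v _ ↦ ?_
          exact pow_le_pow_left₀ (hg v) (hgh v) _
      _ = _ := by
          simp only [mul_pow, Finset.prod_mul_distrib]
          rw [Finset.prod_pow_eq_pow_sum, InfinitePlace.sum_mult_eq, ← pow_mul, mul_comm F.natDegree]
  have h1 := hpow N B (fun v ↦ supNorm_nonneg _) fun v ↦ by
    simpa using supNorm_le_two_pow_mul_mahlerMeasure (F.map v.embedding)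
  have h2 := hpow B N (fun v ↦ (hBpos v).le) fun v ↦ by
    simpa using mahlerMeasure_le_two_pow_mul_supNorm (F.map v.embedding)
  have hBprod : 0 < ∏ v, B v ^ v.mult := Finset.prod_pos fun v _ ↦ pow_pos (hBpos v) _
  have hfpos : 0 < f := pos_of_mul_pos_right (hZ' ▸ hZpos) hBprod.le
  have hHpos : 0 < mulHeight fun i : F.support ↦ F.coeff i := mulHeight_pos _
  have h3 : mulHeight (fun i : F.support ↦ F.coeff i) ≤ 2 ^ (finrank ℚ L * F.natDegree) * Z := by
    rw [hH, hZ', ← mul_assoc]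
    exact mul_le_mul_of_nonneg_right h1 hfpos.le
  have h4 : Z ≤ 2 ^ (finrank ℚ L * F.natDegree) * mulHeight fun i : F.support ↦ F.coeff i := by
    rw [hH, hZ', ← mul_assoc]
    exact mul_le_mul_of_nonneg_right h2 hfpos.le
  have hlogZ : (F.roots.map logHeight₁).sum = Real.log Z := by
    rw [hZ]
    generalize F.roots = s
    induction s using Multiset.induction with
    | empty => simp
    | cons a s ih =>
      have hs : (s.map mulHeight₁).prod ≠ 0 := by
        simp [Multiset.prod_eq_zero_iff, mulHeight₁_ne_zero]
      simp only [Multiset.map_cons, Multiset.sum_cons, Multiset.prod_cons]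
      rw [Real.log_mul (mulHeight₁_ne_zero a) hs, ih, logHeight₁_eq_log_mulHeight₁]
  have h5 := Real.log_le_log hHpos h3
  have h6 := Real.log_le_log hZpos h4
  rw [Real.log_mul (by positivity) hZpos.ne', Real.log_pow] at h5
  rw [Real.log_mul (by positivity) hHpos.ne', Real.log_pow] at h6
  push_cast at h5 h6
  rw [hlogZ, abs_le]
  constructor <;> linarith

/-! ### Counting edges in bipartite graphs -/

theorem card_mul_le_card_mul_of_fibers {ε X Y : Type*} [DecidableEq X] [DecidableEq Y]
    (E : Finset ε) (f : ε → X) (g : ε → Y) {S : Finset X} {T : Finset Y} {m n : ℕ}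
    (hmap : ∀ e ∈ E, f e ∈ S → g e ∈ T)
    (hlow : ∀ x ∈ S, m ≤ (E.filter fun e ↦ f e = x).card)
    (hup : ∀ y ∈ T, (E.filter fun e ↦ g e = y).card ≤ n) :
    S.card * m ≤ T.card * n := by
  have h1 : (E.filter fun e ↦ f e ∈ S).card = ∑ x ∈ S, (E.filter fun e ↦ f e = x).card := by
    rw [Finset.card_eq_sum_card_fiberwise (f := f) (t := S) (s := E.filter fun e ↦ f e ∈ S)
      (fun e he ↦ (Finset.mem_filter.mp he).2)]
    refine Finset.sum_congr rfl fun x hx ↦ ?_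
    rw [Finset.filter_filter]
    congr 1
    refine Finset.filter_congr fun e _ ↦ ?_
    constructor
    · exact fun h ↦ h.2
    · rintro rfl; exact ⟨hx, rfl⟩
  have h2 : (E.filter fun e ↦ f e ∈ S).card ≤ ∑ y ∈ T, (E.filter fun e ↦ g e = y).card := by
    rw [Finset.card_eq_sum_card_fiberwise (f := g) (t := T) (s := E.filter fun e ↦ f e ∈ S) fun e he ↦
      hmap e (Finset.mem_filter.mp he).1 (Finset.mem_filter.mp he).2]
    refine Finset.sum_le_sum fun y _ ↦ Finset.card_le_card fun e he ↦ ?_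
    simp only [Finset.mem_filter] at he ⊢
    exact ⟨he.1.1, he.2⟩
  calc S.card * m ≤ ∑ x ∈ S, (E.filter fun e ↦ f e = x).card := by
        simpa using Finset.card_nsmul_le_sum S _ m hlow
    _ ≤ ∑ y ∈ T, (E.filter fun e ↦ g e = y).card := h1 ▸ h2
    _ ≤ T.card * n := by simpa using Finset.sum_le_card_nsmul T _ n hup

/-- Removing from an edge set `E` the star of all edges over one end point `h e₀`. -/
theorem sum_filter_ne_of_card_fiber_le {ε X : Type*} [DecidableEq X] (h : ε → X) (w : ε → ℝ)
    (u : X → ℝ) {d : ℝ} {E : Finset ε} (hw : ∀ e ∈ E, 0 ≤ w e) (hu : ∀ e ∈ E, w e ≤ u (h e))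
    {e₀ : ε} (he₀ : e₀ ∈ E) (hcard : ((E.filter fun e ↦ h e = h e₀).card : ℝ) ≤ d) :
    ∑ e ∈ E, w e ≤ ∑ e ∈ E.filter (fun e ↦ ¬ h e = h e₀), w e + d * u (h e₀) ∧
      ∑ x ∈ (E.filter fun e ↦ ¬ h e = h e₀).image h, u x + u (h e₀) ≤ ∑ x ∈ E.image h, u x := by
  have hu0 : ∀ x ∈ E.image h, 0 ≤ u x := fun x hx ↦ by
    obtain ⟨e, he, rfl⟩ := Finset.mem_image.mp hx
    exact (hw e he).trans (hu e he)
  have hx : h e₀ ∈ E.image h := Finset.mem_image_of_mem h he₀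
  constructor
  · rw [← Finset.sum_filter_add_sum_filter_not E (fun e ↦ h e = h e₀) w, add_comm]
    gcongr
    refine (Finset.sum_le_card_nsmul _ _ (u (h e₀)) fun e he ↦ ?_).trans ?_
    · obtain ⟨h₁, h₂⟩ := Finset.mem_filter.mp he
      exact h₂ ▸ hu e h₁
    · rw [nsmul_eq_mul]
      exact mul_le_mul_of_nonneg_right hcard (hu0 _ hx)
  · rw [← Finset.sum_erase_add _ _ hx]
    gcongr
    · intro x hx' _
      exact hu0 x (Finset.mem_of_mem_erase hx')
    · intro x hx'
      obtain ⟨e, he, rfl⟩ := Finset.mem_image.mp hx'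
      obtain ⟨h₁, h₂⟩ := Finset.mem_filter.mp he
      exact Finset.mem_erase.mpr ⟨h₂, Finset.mem_image_of_mem h h₁⟩

/-- Weighted edge bound for a bipartite graph with edge set `E` and end point maps `f`, `g`. If every
nonempty subgraph has a vertex of degree at most `d₁` on the left or at most `d₂` on the right, the
edges can be removed one star at a time, and each star is paid for by its centre. -/
theorem sum_le_of_forall_exists_small_fiber {ε X Y : Type*} [DecidableEq X] [DecidableEq Y]
    (f : ε → X) (g : ε → Y) (w : ε → ℝ) (u : X → ℝ) (v : Y → ℝ) {d₁ d₂ : ℝ}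
    (E : Finset ε) (hd₁ : 0 ≤ d₁) (hd₂ : 0 ≤ d₂)
    (hw : ∀ e ∈ E, 0 ≤ w e) (hu : ∀ e ∈ E, w e ≤ u (f e)) (hv : ∀ e ∈ E, w e ≤ v (g e))
    (hE : ∀ E' ⊆ E, E'.Nonempty →
      (∃ e ∈ E', ((E'.filter fun e' ↦ f e' = f e).card : ℝ) ≤ d₁) ∨
      (∃ e ∈ E', ((E'.filter fun e' ↦ g e' = g e).card : ℝ) ≤ d₂)) :
    ∑ e ∈ E, w e ≤ d₁ * ∑ x ∈ E.image f, u x + d₂ * ∑ y ∈ E.image g, v y := by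
  induction E using Finset.strongInduction with
  | H E ih =>
  rcases E.eq_empty_or_nonempty with rfl | hne
  · simp
  have ih' : ∀ E' ⊂ E, ∑ e ∈ E', w e ≤
      d₁ * ∑ x ∈ E'.image f, u x + d₂ * ∑ y ∈ E'.image g, v y := fun E' hss ↦
    ih _ hss (fun e h ↦ hw e (hss.1 h)) (fun e h ↦ hu e (hss.1 h))
      (fun e h ↦ hv e (hss.1 h)) (fun E'' h ↦ hE E'' (h.trans hss.1))
  rcases hE E subset_rfl hne with ⟨e, he, hcard⟩ | ⟨e, he, hcard⟩
  · have hss : E.filter (fun e' ↦ ¬ f e' = f e) ⊂ E :=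
      Finset.filter_ssubset.mpr ⟨e, he, by simp⟩
    obtain ⟨h₁, h₂⟩ := sum_filter_ne_of_card_fiber_le f w u hw hu he hcard
    have h₃ : ∑ y ∈ (E.filter fun e' ↦ ¬ f e' = f e).image g, v y ≤ ∑ y ∈ E.image g, v y :=
      Finset.sum_le_sum_of_subset_of_nonneg (Finset.image_subset_image hss.1) fun y hy _ ↦ by
        obtain ⟨e', he', rfl⟩ := Finset.mem_image.mp hy
        exact (hw e' he').trans (hv e' he')
    have h₄ := mul_le_mul_of_nonneg_left h₂ hd₁
    have h₅ := mul_le_mul_of_nonneg_left h₃ hd₂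
    linarith [ih' _ hss]
  · have hss : E.filter (fun e' ↦ ¬ g e' = g e) ⊂ E :=
      Finset.filter_ssubset.mpr ⟨e, he, by simp⟩
    obtain ⟨h₁, h₂⟩ := sum_filter_ne_of_card_fiber_le g w v hw hv he hcard
    have h₃ : ∑ x ∈ (E.filter fun e' ↦ ¬ g e' = g e).image f, u x ≤ ∑ x ∈ E.image f, u x :=
      Finset.sum_le_sum_of_subset_of_nonneg (Finset.image_subset_image hss.1) fun x hx _ ↦ by
        obtain ⟨e', he', rfl⟩ := Finset.mem_image.mp hx
        exact (hw e' he').trans (hu e' he')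
    have h₄ := mul_le_mul_of_nonneg_left h₂ hd₂
    have h₅ := mul_le_mul_of_nonneg_left h₃ hd₁
    linarith [ih' _ hss]

/-! ### Powers of an element up to torsion prime to `p` -/

section LocalPowers

variable {G : Type*} [CommGroupWithZero G] {β : G}

/-- `x` is, up to torsion of order prime to `p`, a power of `β` with exponent in the localization
of `ℤ` at `p` (a quotient of natural numbers with denominator prime to `p`). -/
def IsLocalPow (p : ℕ) (β x : G) : Prop :=
  ∃ m k : ℕ, ¬ p ∣ m ∧ x ^ m = β ^ k

/-- As `IsLocalPow`, with an exponent that is divisible by `p`. -/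
def IsLocalDvdPow (p : ℕ) (β x : G) : Prop :=
  ∃ m k : ℕ, ¬ p ∣ m ∧ x ^ m = β ^ (p * k)

theorem isLocalPow_self {p : ℕ} (hp : p.Prime) (β : G) : IsLocalPow p β β :=
  ⟨1, 1, hp.one_lt.ne' ∘ Nat.dvd_one.mp, rfl⟩

theorem not_isLocalDvdPow_self {p : ℕ} (hβ : Function.Injective fun i : ℕ ↦ β ^ i) :
    ¬ IsLocalDvdPow p β β := by
  rintro ⟨m, k, hm, h⟩
  exact hm ⟨k, hβ h⟩

theorem IsLocalPow.pow {p : ℕ} {x : G} (h : IsLocalPow p β x) (a : ℕ) : IsLocalPow p β (x ^ a) := by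
  obtain ⟨m, k, hm, h⟩ := h
  exact ⟨m, k * a, hm, by rw [pow_right_comm, h, pow_mul]⟩

theorem IsLocalPow.isLocalDvdPow_pow {p : ℕ} {x : G} (h : IsLocalPow p β x) :
    IsLocalDvdPow p β (x ^ p) := by
  obtain ⟨m, k, hm, h⟩ := h
  exact ⟨m, k, hm, by rw [pow_right_comm, h, mul_comm, pow_mul]⟩

theorem IsLocalDvdPow.pow {p : ℕ} {x : G} (h : IsLocalDvdPow p β x) (a : ℕ) :
    IsLocalDvdPow p β (x ^ a) := by
  obtain ⟨m, k, hm, h⟩ := h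
  exact ⟨m, k * a, hm, by rw [pow_right_comm, h, ← pow_mul, mul_assoc]⟩

theorem IsLocalPow.of_pow {p a : ℕ} {x : G} (hp : p.Prime) (ha : a.Prime) (hpa : p ≠ a)
    (h : IsLocalPow p β (x ^ a)) : IsLocalPow p β x := by
  obtain ⟨m, k, hm, h⟩ := h
  refine ⟨a * m, k, fun hd ↦ ?_, by rw [pow_mul, h]⟩
  exact (hp.dvd_mul.mp hd).elim (fun h ↦ hpa ((Nat.prime_dvd_prime_iff_eq hp ha).mp h)) hm

theorem IsLocalDvdPow.of_pow {p a : ℕ} {x : G} (hp : p.Prime) (ha : a.Prime) (hpa : p ≠ a)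
    (h : IsLocalDvdPow p β (x ^ a)) : IsLocalDvdPow p β x := by
  obtain ⟨m, k, hm, h⟩ := h
  refine ⟨a * m, k, fun hd ↦ ?_, by rw [pow_mul, h]⟩
  exact (hp.dvd_mul.mp hd).elim (fun h ↦ hpa ((Nat.prime_dvd_prime_iff_eq hp ha).mp h)) hm

/-- An element has at most one `p`-th root among the local powers of `β` at `p`: two of them have
the same exponent, so they differ by torsion whose order is prime to `p` and divides `p`. -/
theorem IsLocalPow.eq_of_pow_eq {p : ℕ} {x y : G} (hp : p.Prime)
    (hβ : Function.Injective fun i : ℕ ↦ β ^ i) (hx : IsLocalPow p β x) (hy : IsLocalPow p β y)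
    (h : x ^ p = y ^ p) : x = y := by
  have hβ0 : β ≠ 0 := by
    rintro rfl
    exact absurd (@hβ 1 2 (by simp)) (by norm_num)
  obtain ⟨m, k, hm, hx⟩ := hx
  obtain ⟨n, j, hn, hy⟩ := hy
  have hy0 : y ≠ 0 := by
    rintro rfl
    rw [zero_pow (by rintro rfl; exact hn (dvd_zero p))] at hy
    exact pow_ne_zero j hβ0 hy.symm
  have hkj : k * n = j * m := by
    have : β ^ (p * (k * n)) = β ^ (p * (j * m)) := by
      calc β ^ (p * (k * n)) = ((β ^ k) ^ n) ^ p := by rw [← pow_mul, ← pow_mul]; congr 1; ring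
        _ = (x ^ p) ^ (m * n) := by rw [← hx, ← pow_mul, ← pow_mul, ← pow_mul]; congr 1; ring
        _ = ((β ^ j) ^ m) ^ p := by
          rw [h, ← hy, ← pow_mul, ← pow_mul, ← pow_mul]; congr 1; ring
        _ = β ^ (p * (j * m)) := by rw [← pow_mul, ← pow_mul]; congr 1; ring
    exact Nat.eq_of_mul_eq_mul_left hp.pos (hβ this)
  have hpow : x ^ (m * n) = y ^ (m * n) := by
    rw [pow_mul, hx, mul_comm m n, pow_mul, hy, ← pow_mul, ← pow_mul, hkj]
  have hcop : p.Coprime (m * n) :=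
    (hp.coprime_iff_not_dvd.mpr hm).mul_right (hp.coprime_iff_not_dvd.mpr hn)
  have h1 : (x / y) ^ p = 1 := by rw [div_pow, h, div_self (pow_ne_zero _ hy0)]
  have h2 : (x / y) ^ (m * n) = 1 := by rw [div_pow, hpow, div_self (pow_ne_zero _ hy0)]
  have h3 : orderOf (x / y) ∣ 1 := by
    rw [← hcop.gcd_eq_one]
    exact Nat.dvd_gcd (orderOf_dvd_of_pow_eq_one h1) (orderOf_dvd_of_pow_eq_one h2)
  exact (div_eq_one_iff_eq hy0).mp (orderOf_eq_one_iff.mp (Nat.dvd_one.mp h3))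

end LocalPowers

/-! ### Growth of the power graph -/

section PowerGraph

variable {G : Type*} [CommGroupWithZero G]

open Classical in
/-- The elements of `A` at which `x` has a positive exponent relative to `β`. -/
noncomputable def posPrimes (A : Finset ℕ) (β x : G) : Finset ℕ :=
  A.filter fun p ↦ IsLocalDvdPow p β x

open Classical in
/-- The elements of `A` at which `x` is not a local power of `β`: the exponent of `x` relative to
`β` has a denominator, or it is integral there but `x` differs from the power by torsion. -/
noncomputable def negPrimes (A : Finset ℕ) (β x : G) : Finset ℕ :=
  A.filter fun p ↦ ¬ IsLocalPow p β x

variable {A : Finset ℕ} {β : G}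

theorem posPrimes_self (A : Finset ℕ) (hβ : Function.Injective fun i : ℕ ↦ β ^ i) :
    posPrimes A β β = ∅ := by
  classical
  exact Finset.filter_eq_empty_iff.mpr fun _ _ ↦ not_isLocalDvdPow_self hβ

theorem negPrimes_self (hA : ∀ p ∈ A, p.Prime) (β : G) : negPrimes A β β = ∅ := by
  classical
  exact Finset.filter_eq_empty_iff.mpr fun p hp h ↦ h (isLocalPow_self (hA p hp) β)

theorem posPrimes_pow_subset (hA : ∀ p ∈ A, p.Prime) (x : G) {a : ℕ} (ha : a.Prime) :
    posPrimes A β (x ^ a) ⊆ insert a (posPrimes A β x) := by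
  intro p hp
  simp only [posPrimes, Finset.mem_insert, Finset.mem_filter] at hp ⊢
  by_cases hpa : p = a
  · exact Or.inl hpa
  · exact Or.inr ⟨hp.1, hp.2.of_pow (hA p hp.1) ha hpa⟩

theorem negPrimes_pow_subset (x : G) (a : ℕ) : negPrimes A β (x ^ a) ⊆ negPrimes A β x := by
  intro p hp
  simp only [negPrimes, Finset.mem_filter] at hp ⊢
  exact ⟨hp.1, fun h ↦ hp.2 (h.pow a)⟩

theorem posPrimes_subset_pow (x : G) (a : ℕ) : posPrimes A β x ⊆ posPrimes A β (x ^ a) := by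
  intro p hp
  simp only [posPrimes, Finset.mem_filter] at hp ⊢
  exact ⟨hp.1, hp.2.pow a⟩

theorem negPrimes_subset_insert_pow (hA : ∀ p ∈ A, p.Prime) (x : G) {a : ℕ} (ha : a.Prime) :
    negPrimes A β x ⊆ insert a (negPrimes A β (x ^ a)) := by
  intro p hp
  simp only [negPrimes, Finset.mem_insert, Finset.mem_filter] at hp ⊢
  by_cases hpa : p = a
  · exact Or.inl hpa
  · exact Or.inr ⟨hp.1, fun h ↦ hp.2 (h.of_pow (hA p hp.1) ha hpa)⟩

open Classical in
/-- A right vertex `s` has at most one edge `(x, a)` for each `a`, with `x` a local power of `β` at `a`,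
and `s` then has positive exponent at `a`. -/
theorem card_filter_isLocalPow_le (hA : ∀ p ∈ A, p.Prime)
    (hβ : Function.Injective fun i : ℕ ↦ β ^ i) {E : Finset (G × ℕ)} (hE : ∀ e ∈ E, e.2 ∈ A)
    (s : G) :
    (E.filter fun e ↦ IsLocalPow e.2 β e.1 ∧ e.1 ^ e.2 = s).card ≤ (posPrimes A β s).card := by
  refine Finset.card_le_card_of_injOn Prod.snd (fun e he ↦ ?_) fun e he e' he' h ↦ ?_
  · obtain ⟨h, h₁, h₂⟩ := Finset.mem_filter.mp he
    exact Finset.mem_filter.mpr ⟨hE e h, h₂ ▸ h₁.isLocalDvdPow_pow⟩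
  · obtain ⟨h₀, h₁, h₂⟩ := Finset.mem_filter.mp he
    obtain ⟨h₀', h₁', h₂'⟩ := Finset.mem_filter.mp he'
    obtain ⟨x, a⟩ := e
    obtain ⟨x', a'⟩ := e'
    obtain rfl : a = a' := h
    exact Prod.ext (h₁.eq_of_pow_eq (hA _ (hE _ h₀)) hβ h₁' (h₂.trans h₂'.symm)) rfl

open Classical in
theorem card_filter_not_isLocalPow_le {E : Finset (G × ℕ)} (hE : ∀ e ∈ E, e.2 ∈ A) (x : G) :
    (E.filter fun e ↦ ¬ IsLocalPow e.2 β e.1 ∧ e.1 = x).card ≤ (negPrimes A β x).card := by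
  refine Finset.card_le_card_of_injOn Prod.snd (fun e he ↦ ?_) fun e he e' he' h ↦ ?_
  · obtain ⟨h, h₁, h₂⟩ := Finset.mem_filter.mp he
    exact Finset.mem_filter.mpr ⟨hE e h, h₂ ▸ h₁⟩
  · obtain ⟨h₀, h₁, h₂⟩ := Finset.mem_filter.mp he
    obtain ⟨h₀', h₁', h₂'⟩ := Finset.mem_filter.mp he'
    exact Prod.ext (h₂.trans h₂'.symm) h

open Classical in
/-- The left end points of `E` that have at most `k` positive and at most `k` negative primes. -/
noncomputable def leftLevel (A : Finset ℕ) (β : G) (E : Finset (G × ℕ)) (k : ℕ) : Finset G :=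
  (E.image Prod.fst).filter fun x ↦ (posPrimes A β x).card ≤ k ∧ (negPrimes A β x).card ≤ k

open Classical in
/-- The right end points of `E` that have at most `k + 1` positive and at most `k` negative
primes. -/
noncomputable def rightLevel (A : Finset ℕ) (β : G) (E : Finset (G × ℕ)) (k : ℕ) : Finset G :=
  (E.image fun e ↦ e.1 ^ e.2).filter fun s ↦
    (posPrimes A β s).card ≤ k + 1 ∧ (negPrimes A β s).card ≤ k

open Classical in
/-- Forward step: edges `(x, a)` for which `x` is a local power of `β` at `a`. A vertex `x` of level
`k` has at least `D - k` of them, and at most `k + 1` of them meet in a vertex on the right. -/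
theorem card_leftLevel_mul_le (hA : ∀ p ∈ A, p.Prime)
    (hβ : Function.Injective fun i : ℕ ↦ β ^ i) {E : Finset (G × ℕ)} (hE : ∀ e ∈ E, e.2 ∈ A) {D : ℕ}
    (hD : ∀ e ∈ E, D ≤ (E.filter fun e' ↦ e'.1 = e.1).card) (k : ℕ) :
    (leftLevel A β E k).card * (D - k) ≤ (rightLevel A β E k).card * (k + 1) := by
  refine card_mul_le_card_mul_of_fibers (E.filter fun e ↦ IsLocalPow e.2 β e.1) Prod.fst
    (fun e ↦ e.1 ^ e.2) ?_ ?_ ?_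
  · intro e he hx
    obtain ⟨he, -⟩ := Finset.mem_filter.mp he
    obtain ⟨-, h₁, h₂⟩ := Finset.mem_filter.mp hx
    refine Finset.mem_filter.mpr ⟨Finset.mem_image_of_mem (fun e : G × ℕ ↦ e.1 ^ e.2) he, ?_, ?_⟩
    · refine (Finset.card_le_card (posPrimes_pow_subset hA e.1 (hA _ (hE e he)))).trans ?_
      exact (Finset.card_insert_le _ _).trans (by omega)
    · exact (Finset.card_le_card (negPrimes_pow_subset e.1 e.2)).trans h₂
  · intro x hx
    obtain ⟨hx, h₁, h₂⟩ := Finset.mem_filter.mp hx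
    obtain ⟨e, he, rfl⟩ := Finset.mem_image.mp hx
    have h₃ := card_filter_not_isLocalPow_le (β := β) hE e.1
    have h₄ := hD e he
    have h₅ := Finset.card_filter_add_card_filter_not (s := E.filter fun e' ↦ e'.1 = e.1)
      (fun e' ↦ IsLocalPow e'.2 β e'.1)
    simp only [Finset.filter_filter] at h₅ ⊢
    simp only [and_comm (a := _ = _)] at h₅ ⊢
    omega
  · intro s hs
    obtain ⟨-, h₁, -⟩ := Finset.mem_filter.mp hs
    rw [Finset.filter_filter]
    exact (card_filter_isLocalPow_le hA hβ hE s).trans h₁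

open Classical in
/-- Backward step: edges `(y, b)` for which `y` is not a local power of `β` at `b`. A vertex on the
right of level `k` has at least `D - (k + 1)` of them, and at most `k + 1` of them meet in a vertex
on the left. -/
theorem card_rightLevel_mul_le (hA : ∀ p ∈ A, p.Prime)
    (hβ : Function.Injective fun i : ℕ ↦ β ^ i) {E : Finset (G × ℕ)} (hE : ∀ e ∈ E, e.2 ∈ A) {D : ℕ}
    (hD : ∀ e ∈ E, D ≤ (E.filter fun e' ↦ e'.1 ^ e'.2 = e.1 ^ e.2).card) (k : ℕ) :
    (rightLevel A β E k).card * (D - (k + 1)) ≤ (leftLevel A β E (k + 1)).card * (k + 1) := by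
  refine card_mul_le_card_mul_of_fibers (E.filter fun e ↦ ¬ IsLocalPow e.2 β e.1)
    (fun e ↦ e.1 ^ e.2) Prod.fst ?_ ?_ ?_
  · intro e he hs
    obtain ⟨he, -⟩ := Finset.mem_filter.mp he
    obtain ⟨-, h₁, h₂⟩ := Finset.mem_filter.mp hs
    refine Finset.mem_filter.mpr ⟨Finset.mem_image_of_mem _ he, ?_, ?_⟩
    · exact (Finset.card_le_card (posPrimes_subset_pow e.1 e.2)).trans h₁
    · refine (Finset.card_le_card (negPrimes_subset_insert_pow hA e.1 (hA _ (hE e he)))).trans ?_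
      exact (Finset.card_insert_le _ _).trans (by omega)
  · intro s hs
    obtain ⟨hs, h₁, h₂⟩ := Finset.mem_filter.mp hs
    obtain ⟨e, he, rfl⟩ := Finset.mem_image.mp hs
    have h₃ := card_filter_isLocalPow_le hA hβ hE (e.1 ^ e.2)
    have h₄ := hD e he
    have h₅ := Finset.card_filter_add_card_filter_not
      (s := E.filter fun e' ↦ e'.1 ^ e'.2 = e.1 ^ e.2) (fun e' ↦ IsLocalPow e'.2 β e'.1)
    simp only [Finset.filter_filter] at h₅ ⊢
    simp only [and_comm (a := _ = _)] at h₅ ⊢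
    omega
  · intro x hx
    obtain ⟨-, -, h₂⟩ := Finset.mem_filter.mp hx
    rw [Finset.filter_filter]
    exact (card_filter_not_isLocalPow_le hE x).trans h₂

open Classical in
/-- Growth of the power graph: alternating `k + 1` forward and `k` backward steps from any left
vertex. -/
theorem choose_mul_choose_le_card_image_pow (hA : ∀ p ∈ A, p.Prime) {E : Finset (G × ℕ)}
    (hEne : E.Nonempty) (hE : ∀ e ∈ E, e.2 ∈ A)
    (htors : ∀ e ∈ E, Function.Injective fun i : ℕ ↦ e.1 ^ i) {D D' : ℕ}
    (hD : ∀ e ∈ E, D ≤ (E.filter fun e' ↦ e'.1 = e.1).card)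
    (hD' : ∀ e ∈ E, D' + 1 ≤ (E.filter fun e' ↦ e'.1 ^ e'.2 = e.1 ^ e.2).card) (k : ℕ) :
    D.choose (k + 1) * D'.choose k ≤ (E.image fun e ↦ e.1 ^ e.2).card := by
  obtain ⟨e₀, he₀⟩ := hEne
  set β := e₀.1 with hβdef
  have hβ : Function.Injective fun i : ℕ ↦ β ^ i := htors e₀ he₀
  have hL := card_leftLevel_mul_le hA hβ hE hD
  have hR := card_rightLevel_mul_le hA hβ hE hD'
  have h0 : 1 ≤ (leftLevel A β E 0).card := by
    refine Finset.card_pos.mpr ⟨β, Finset.mem_filter.mpr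
      ⟨Finset.mem_image_of_mem _ he₀, ?_, ?_⟩⟩
    · rw [posPrimes_self A hβ, Finset.card_empty]
    · rw [negPrimes_self hA β, Finset.card_empty]
  -- passing from `j` to `j + 1` is a backward step followed by a forward step
  have key : ∀ j, D.choose (j + 1) * D'.choose j ≤ (rightLevel A β E j).card := by
    intro j
    induction j with
    | zero =>
      have := hL 0
      simp only [Nat.sub_zero, zero_add, mul_one, Nat.choose_one_right, Nat.choose_zero_right]
        at this ⊢
      nlinarith
    | succ j ih =>
      have h1 := Nat.choose_succ_right_eq D (j + 1)
      have h2 := Nat.choose_succ_right_eq D' j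
      have h3 := hL (j + 1)
      have h4 := hR j
      rw [Nat.add_sub_add_right] at h4
      refine Nat.le_of_mul_le_mul_right (c := (j + 1 + 1) * (j + 1)) ?_ (by positivity)
      calc D.choose (j + 1 + 1) * D'.choose (j + 1) * ((j + 1 + 1) * (j + 1))
          = (D.choose (j + 1 + 1) * (j + 1 + 1)) * (D'.choose (j + 1) * (j + 1)) := by ring
        _ = (D.choose (j + 1) * D'.choose j) * (D' - j) * (D - (j + 1)) := by rw [h1, h2]; ring
        _ ≤ (rightLevel A β E j).card * (D' - j) * (D - (j + 1)) := by gcongr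
        _ ≤ (leftLevel A β E (j + 1)).card * (j + 1) * (D - (j + 1)) := by gcongr
        _ = (leftLevel A β E (j + 1)).card * (D - (j + 1)) * (j + 1) := by ring
        _ ≤ (rightLevel A β E (j + 1)).card * (j + 1 + 1) * (j + 1) := by gcongr
        _ = _ := by ring
  exact (key k).trans (Finset.card_le_card (Finset.filter_subset _ _))

end PowerGraph

/-! ### Estimates for binomial coefficients -/

/-- Raising `j` by one multiplies the left side by `(2 D - 3 - j) / (j + 3)` and the right side by at
least as much. -/
theorem choose_lt_two_pow_mul {ℓ D : ℕ} (hℓ : 2 ≤ ℓ) (hD : ℓ + 2 ≤ D) {j : ℕ} (hj : j ≤ ℓ) :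
    (2 * D - 1).choose (j + 2) <
      2 ^ (j + 1) * (j + 1).factorial * ((3 * ℓ).choose (j + 1) * D.choose (j + 2)) := by
  induction j with
  | zero =>
    obtain ⟨d, rfl⟩ : ∃ d, D = d + 2 := ⟨D - 2, by omega⟩
    have h1 := Nat.choose_succ_right_eq (2 * (d + 2) - 1) 1
    have h2 := Nat.choose_succ_right_eq (d + 2) 1
    simp only [Nat.choose_one_right, Nat.reduceAdd, zero_add, pow_one, Nat.factorial_one,
      mul_one] at h1 h2 ⊢
    have h3 : 2 * (d + 2) - 1 = 2 * d + 3 := by omega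
    rw [h3] at h1 ⊢
    have h4 : 2 * d + 3 - 1 = 2 * d + 2 := by omega
    have h5 : d + 2 - 1 = d + 1 := by omega
    rw [h4] at h1
    rw [h5] at h2
    have h6 : 6 * ((d + 2).choose 2 * 2) ≤ 3 * ℓ * ((d + 2).choose 2 * 2) := by
      gcongr; omega
    nlinarith
  | succ j ih =>
    have ih := ih (by omega)
    obtain ⟨u, hu⟩ : ∃ u, D = j + 3 + u := ⟨D - (j + 3), by omega⟩
    have h1 := Nat.choose_succ_right_eq (2 * D - 1) (j + 2)
    have h2 := Nat.choose_succ_right_eq D (j + 2)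
    have h3 := Nat.choose_succ_right_eq (3 * ℓ) (j + 1)
    have h4 : 2 * D - 1 - (j + 2) ≤ 2 * ((3 * ℓ - (j + 1)) * (D - (j + 2))) := by
      have h5 : D - (j + 2) = u + 1 := by omega
      have h6 : 2 * D - 1 - (j + 2) = 2 * u + j + 3 := by omega
      have h7 : 2 * ℓ ≤ 3 * ℓ - (j + 1) := by omega
      rw [h5, h6]
      nlinarith [Nat.mul_le_mul_right (u + 1) h7, Nat.mul_le_mul_right u hℓ]
    have h5 : 0 < 2 * D - 1 - (j + 2) := by omega
    refine Nat.lt_of_mul_lt_mul_right (a := j + 2 + 1) ?_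
    calc (2 * D - 1).choose (j + 1 + 2) * (j + 2 + 1)
        = (2 * D - 1).choose (j + 2) * (2 * D - 1 - (j + 2)) := h1
      _ < 2 ^ (j + 1) * (j + 1).factorial * ((3 * ℓ).choose (j + 1) * D.choose (j + 2)) *
          (2 * D - 1 - (j + 2)) := Nat.mul_lt_mul_of_pos_right ih h5
      _ ≤ 2 ^ (j + 1) * (j + 1).factorial * ((3 * ℓ).choose (j + 1) * D.choose (j + 2)) *
          (2 * ((3 * ℓ - (j + 1)) * (D - (j + 2)))) := by gcongr
      _ = 2 ^ (j + 1 + 1) * (j + 1).factorial * (((3 * ℓ).choose (j + 1) * (3 * ℓ - (j + 1))) *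
          (D.choose (j + 2) * (D - (j + 2)))) := by ring
      _ = _ := by
        rw [← h2, ← h3, Nat.factorial_succ (j + 1)]; ring

theorem factorial_two_mul_lt {ℓ : ℕ} (hℓ : 2 ≤ ℓ) :
    (2 * ℓ + 2).factorial <
      2 ^ (ℓ + 1) * (ℓ + 1).factorial * ((ℓ + 2).factorial * ℓ.factorial) := by
  induction ℓ, hℓ using Nat.le_induction with
  | base => decide
  | succ ℓ hℓ ih =>
    have h1 : (2 * (ℓ + 1) + 2).factorial = (2 * ℓ + 4) * ((2 * ℓ + 3) * (2 * ℓ + 2).factorial) := by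
      rw [show 2 * (ℓ + 1) + 2 = (2 * ℓ + 3) + 1 by ring, Nat.factorial_succ,
        Nat.factorial_succ (2 * ℓ + 2)]
    have h2 : (ℓ + 1 + 1).factorial = (ℓ + 2) * (ℓ + 1).factorial := Nat.factorial_succ _
    have h3 : (ℓ + 1 + 2).factorial = (ℓ + 3) * (ℓ + 2).factorial := Nat.factorial_succ _
    have h4 : (ℓ + 1).factorial = (ℓ + 1) * ℓ.factorial := Nat.factorial_succ _
    rw [h1, h2, h3]
    nth_rewrite 2 [h4]
    calc (2 * ℓ + 4) * ((2 * ℓ + 3) * (2 * ℓ + 2).factorial)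
        = (2 * (ℓ + 2)) * (2 * ℓ + 3) * (2 * ℓ + 2).factorial := by ring
      _ < (2 * (ℓ + 2)) * (2 * ℓ + 3) *
          (2 ^ (ℓ + 1) * (ℓ + 1).factorial * ((ℓ + 2).factorial * ℓ.factorial)) := by gcongr
      _ ≤ (2 * (ℓ + 2)) * ((ℓ + 3) * (ℓ + 1)) *
          (2 ^ (ℓ + 1) * (ℓ + 1).factorial * ((ℓ + 2).factorial * ℓ.factorial)) := by
        gcongr; nlinarith
      _ = _ := by ring

theorem two_mul_add_three_le_of_le_choose {ℓ N : ℕ} (hℓ : 2 ≤ ℓ)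
    (h : 2 ^ (ℓ + 1) * (ℓ + 1).factorial ≤ N.choose (ℓ + 2)) : 2 * ℓ + 3 ≤ N := by
  by_contra! hN
  have h1 : N.choose (ℓ + 2) ≤ (2 * ℓ + 2).choose (ℓ + 2) := Nat.choose_le_choose _ (by omega)
  have h2 := Nat.choose_mul_factorial_mul_factorial (show ℓ + 2 ≤ 2 * ℓ + 2 by omega)
  rw [show 2 * ℓ + 2 - (ℓ + 2) = ℓ by omega, mul_assoc] at h2
  have h3 := factorial_two_mul_lt hℓ
  rw [← h2] at h3
  exact absurd (h.trans h1) (not_le.mpr (Nat.lt_of_mul_lt_mul_right h3))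

/-- The size condition of the theorem, put in the form that contradicts the growth of the power graph
with minimal degrees above `N / 2` and `3 ℓ`. -/
theorem lt_choose_mul_choose {ℓ N n : ℕ} (hℓ : 2 ≤ ℓ) (hn : 1 ≤ n)
    (h : 2 ^ (ℓ + 1) * (ℓ + 1).factorial * n ≤ N.choose (ℓ + 2)) :
    n < (N / 2 + 1).choose (ℓ + 2) * (3 * ℓ).choose (ℓ + 1) := by
  have hN := two_mul_add_three_le_of_le_choose hℓ ((Nat.le_mul_of_pos_right _ hn).trans h)
  have h1 := choose_lt_two_pow_mul hℓ (D := N / 2 + 1) (by omega) le_rfl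
  have h2 : N.choose (ℓ + 2) ≤ (2 * (N / 2 + 1) - 1).choose (ℓ + 2) :=
    Nat.choose_le_choose _ (by omega)
  rw [mul_comm (Nat.choose _ _)]
  exact Nat.lt_of_mul_lt_mul_left ((h.trans h2).trans_lt h1)

/-! ### Comparison of weights on the two sides of the power graph -/

open Classical in
/-- If `T ^ a ⊆ S` for all `a ∈ A`, then `T` is smaller than `S` by a factor `6 ℓ / #A`, for all
weights that do not decrease along the edges `x ↦ x ^ a`. -/
theorem card_mul_sum_le_of_pow_mem {G : Type*} [CommGroupWithZero G] {A : Finset ℕ}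
    (hA : ∀ p ∈ A, p.Prime) {T S : Finset G} {ℓ n : ℕ} (hℓ : 2 ≤ ℓ) (hn : 1 ≤ n)
    (hnA : 2 ^ (ℓ + 1) * (ℓ + 1).factorial * n ≤ A.card.choose (ℓ + 2)) (hS : S.card ≤ n)
    (htors : ∀ x ∈ T, Function.Injective fun i : ℕ ↦ x ^ i) (hTS : ∀ x ∈ T, ∀ a ∈ A, x ^ a ∈ S)
    (w v : G → ℝ) (hw : ∀ x ∈ T, 0 ≤ w x) (hv : ∀ s ∈ S, 0 ≤ v s)
    (hwv : ∀ x ∈ T, ∀ a ∈ A, w x ≤ v (x ^ a)) :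
    (A.card : ℝ) * ∑ x ∈ T, w x ≤ 6 * ℓ * ∑ s ∈ S, v s := by
  have key := sum_le_of_forall_exists_small_fiber (Prod.fst : G × ℕ → G) (fun e ↦ e.1 ^ e.2)
    (fun e ↦ w e.1) w v (d₁ := A.card / 2) (d₂ := 3 * ℓ) (T ×ˢ A) (by positivity) (by positivity)
    (fun e he ↦ hw _ (Finset.mem_product.mp he).1) (fun e _ ↦ le_rfl)
    (fun e he ↦ hwv _ (Finset.mem_product.mp he).1 _ (Finset.mem_product.mp he).2) ?_
  · have h1 : ∑ e ∈ T ×ˢ A, w e.1 = A.card * ∑ x ∈ T, w x := by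
      rw [Finset.sum_product, Finset.mul_sum]
      simp
    have h2 : ∑ x ∈ (T ×ˢ A).image Prod.fst, w x ≤ ∑ x ∈ T, w x :=
      Finset.sum_le_sum_of_subset_of_nonneg (fun x hx ↦ by
        obtain ⟨e, he, rfl⟩ := Finset.mem_image.mp hx
        exact (Finset.mem_product.mp he).1) fun x hx _ ↦ hw x hx
    have h3 : ∑ s ∈ (T ×ˢ A).image (fun e ↦ e.1 ^ e.2), v s ≤ ∑ s ∈ S, v s :=
      Finset.sum_le_sum_of_subset_of_nonneg (fun x hx ↦ by
        obtain ⟨e, he, rfl⟩ := Finset.mem_image.mp hx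
        exact hTS _ (Finset.mem_product.mp he).1 _ (Finset.mem_product.mp he).2) fun x hx _ ↦ hv x hx
    rw [h1] at key
    have h4 := mul_le_mul_of_nonneg_left h2 (show (0 : ℝ) ≤ A.card / 2 by positivity)
    have h5 := mul_le_mul_of_nonneg_left h3 (show (0 : ℝ) ≤ 3 * ℓ by positivity)
    linarith
  · -- a subgraph without small vertices would have more than `n` right vertices
    intro E' hE' hne
    by_contra! hcon
    obtain ⟨h1, h2⟩ := hcon
    have hmem : ∀ e ∈ E', e.1 ∈ T ∧ e.2 ∈ A := fun e he ↦ Finset.mem_product.mp (hE' he)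
    have h3 := choose_mul_choose_le_card_image_pow hA hne (fun e he ↦ (hmem e he).2)
      (fun e he ↦ htors _ (hmem e he).1) (D := A.card / 2 + 1) (D' := 3 * ℓ) (fun e he ↦ ?_)
      (fun e he ↦ ?_) (ℓ + 1)
    · have h4 : (E'.image fun e ↦ e.1 ^ e.2).card ≤ S.card :=
        Finset.card_le_card fun x hx ↦ by
          obtain ⟨e, he, rfl⟩ := Finset.mem_image.mp hx
          exact hTS _ (hmem e he).1 _ (hmem e he).2
      exact absurd ((h3.trans h4).trans hS) (not_le.mpr (lt_choose_mul_choose hℓ hn hnA))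
    · have := h1 e he
      rw [div_lt_iff₀ two_pos] at this
      have : A.card < (E'.filter fun e' ↦ e'.1 = e.1).card * 2 := by exact_mod_cast this
      omega
    · have : 3 * ℓ < (E'.filter fun e' ↦ e'.1 ^ e'.2 = e.1 ^ e.2).card := by
        exact_mod_cast h2 e he
      omega

/-! ### Common divisors of the polynomials `P(T ^ a)` -/

/-- In characteristic zero `T ^ a - β ^ a` has only a simple zero at `β ≠ 0`. -/
theorem rootMultiplicity_comp_X_pow {L : Type*} [Field L] [CharZero L] {P : L[X]} (hP : P ≠ 0)
    {a : ℕ} (ha : 0 < a) {β : L} (hβ : β ≠ 0) :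
    (P.comp (X ^ a)).rootMultiplicity β = P.rootMultiplicity (β ^ a) := by
  obtain ⟨R, hR, hdvd⟩ := exists_eq_pow_rootMultiplicity_mul_and_not_dvd P hP (β ^ a)
  set m := P.rootMultiplicity (β ^ a)
  obtain ⟨g, hg⟩ : (X - C β) ∣ (X ^ a - C (β ^ a) : L[X]) := by
    rw [C_pow]; exact sub_dvd_pow_sub_pow _ _ _
  have hgβ : g.eval β ≠ 0 := by
    have h := congrArg (fun f : L[X] ↦ (derivative f).eval β) hg
    simp only [derivative_sub, derivative_X_pow, derivative_C, derivative_mul, derivative_X] at h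
    simp only [sub_zero, one_mul, eval_add, eval_mul, eval_sub, eval_X, eval_C, sub_self, zero_mul,
      add_zero, eval_pow] at h
    rw [← h]
    exact mul_ne_zero (Nat.cast_ne_zero.mpr ha.ne') (pow_ne_zero _ hβ)
  have hRβ : (R.comp (X ^ a)).eval β ≠ 0 := by
    rw [eval_comp, eval_pow, eval_X]
    exact fun h ↦ hdvd (dvd_iff_isRoot.mpr h)
  have hcomp : P.comp (X ^ a) = (X - C β) ^ m * (g ^ m * R.comp (X ^ a)) := by
    conv_lhs => rw [hR]
    rw [mul_comp, pow_comp, sub_comp, X_comp, C_comp, hg, mul_pow, mul_assoc]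
  have heval : (g ^ m * R.comp (X ^ a)).eval β ≠ 0 := by
    rw [eval_mul, eval_pow]
    exact mul_ne_zero (pow_ne_zero _ hgβ) hRβ
  have hne : g ^ m * R.comp (X ^ a) ≠ 0 := by
    intro h; rw [h] at heval; simp at heval
  rw [hcomp, mul_comm, rootMultiplicity_mul_X_sub_C_pow hne, rootMultiplicity_eq_zero heval, zero_add]

open Height Module in
/-- The polynomial height of `F` over `K` in terms of the height over an extension `L`. -/
theorem finrank_mul_log_polyHeight {K L : Type*} [Field K] [Field L] [NumberField K]
    [NumberField L] [Algebra K L] (F : K[X]) :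
    finrank ℚ L * Real.log (polyHeight F) =
      Real.log (mulHeight fun i : (F.map (algebraMap K L)).support ↦
        (F.map (algebraMap K L)).coeff i) := by
  have h1 : ∀ s : Finset ℕ, s = F.support →
      mulHeight (fun i : s ↦ (F.map (algebraMap K L)).coeff i) =
        mulHeight (fun i : F.support ↦ F.coeff i) ^ finrank K L := by
    rintro s rfl
    rw [← mulHeight_algebraMap]
    simp only [coeff_map]
  rw [h1 _ (support_map_of_injective F (algebraMap K L).injective), polyHeight,
    Real.log_rpow (mulHeight_pos _), Real.log_pow, ← finrank_mul_finrank ℚ K L]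
  have : (finrank ℚ K : ℝ) ≠ 0 := Nat.cast_ne_zero.mpr finrank_pos.ne'
  push_cast
  field_simp

theorem log_polyHeight_nonneg {K : Type*} [Field K] [NumberField K] (F : K[X]) :
    0 ≤ Real.log (polyHeight F) :=
  Real.log_nonneg (Real.one_le_rpow (Height.one_le_mulHeight _) (by positivity))

theorem pow_injective_of_not_torsion {G : Type*} [CommGroupWithZero G] {x : G} (hx : x ≠ 0)
    (h : ∀ m : ℕ, 0 < m → x ^ m ≠ 1) : Function.Injective fun i : ℕ ↦ x ^ i := by
  have key : ∀ i j : ℕ, i < j → x ^ i ≠ x ^ j := by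
    intro i j hij he
    refine h (j - i) (by omega) (mul_left_cancel₀ (pow_ne_zero i hx) ?_)
    rw [← pow_add, Nat.add_sub_cancel' hij.le, mul_one, he]
  intro i j hij
  rcases lt_trichotomy i j with hlt | heq | hgt
  · exact absurd hij (key i j hlt)
  · exact heq
  · exact absurd hij.symm (key j i hgt)

open Height Module in
/-- The degree and height bounds for a common divisor `Q` of the `P(T ^ a)`, when `P` and `Q` split in
the number field `L`. -/
theorem natDegree_le_and_log_polyHeight_le_of_splits {K L : Type*} [Field K] [Field L]
    [NumberField K] [NumberField L] [Algebra K L] {M n : ℕ} (hM : 2 ≤ M) (hn : 1 ≤ n)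
    {A : Finset ℕ} (hAne : A.Nonempty) (hA : ∀ p ∈ A, p.Prime ∧ (M : ℝ) / 2 ≤ (p : ℝ))
    {P Q : K[X]} (hP : P ≠ 0) (hdeg : P.natDegree ≤ n)
    (hPs : (P.map (algebraMap K L)).Splits) (hQs : (Q.map (algebraMap K L)).Splits)
    (hroots : ∀ x : L, aeval x P = 0 → x ≠ 0 ∧ ∀ m : ℕ, 0 < m → x ^ m ≠ 1)
    (hQ : ∀ a ∈ A, Q ∣ P.comp (X ^ a)) {ℓ : ℕ} (hℓ : 2 ≤ ℓ)
    (hnA : 2 ^ (ℓ + 1) * (ℓ + 1).factorial * n ≤ A.card.choose (ℓ + 2)) :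
    (A.card : ℝ) * Q.natDegree ≤ 6 * ℓ * P.natDegree ∧
      (A.card : ℝ) * M * Real.log (polyHeight Q) ≤
        12 * ℓ * (M * P.natDegree + Real.log (polyHeight P)) := by
  classical
  set p := P.map (algebraMap K L) with hp
  set q := Q.map (algebraMap K L) with hq
  have hp0 : p ≠ 0 := (Polynomial.map_ne_zero_iff (algebraMap K L).injective).mpr hP
  have hcomp : ∀ a ∈ A, q ∣ p.comp (X ^ a) := fun a ha ↦ by
    have := Polynomial.map_dvd (algebraMap K L) (hQ a ha)
    rwa [Polynomial.map_comp, Polynomial.map_pow, map_X] at this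
  have hcomp0 : ∀ a ∈ A, p.comp (X ^ a) ≠ 0 := fun a ha h ↦ by
    rw [← expand_eq_comp_X_pow, expand_eq_zero (hA a ha).1.pos] at h
    exact hp0 h
  have hq0 : q ≠ 0 := by
    obtain ⟨a, ha⟩ := hAne
    exact ne_zero_of_dvd_ne_zero (hcomp0 a ha) (hcomp a ha)
  set T := q.roots.toFinset
  set S := p.roots.toFinset
  have hTS : ∀ x ∈ T, ∀ a ∈ A, x ^ a ∈ S := by
    intro x hx a ha
    have hx : q.eval x = 0 := (mem_roots'.mp (Multiset.mem_toFinset.mp hx)).2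
    refine Multiset.mem_toFinset.mpr (mem_roots'.mpr ⟨hp0, ?_⟩)
    have := eval_eq_zero_of_dvd_of_eval_eq_zero (hcomp a ha) hx
    rwa [eval_comp, eval_pow, eval_X] at this
  have hroot : ∀ s ∈ S, s ≠ 0 ∧ ∀ m : ℕ, 0 < m → s ^ m ≠ 1 := by
    intro s hs
    have hs : p.eval s = 0 := (mem_roots'.mp (Multiset.mem_toFinset.mp hs)).2
    exact hroots s (by rwa [hp, eval_map_algebraMap] at hs)
  have hT : ∀ x ∈ T, x ≠ 0 ∧ ∀ m : ℕ, 0 < m → x ^ m ≠ 1 := by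
    intro x hx
    obtain ⟨a, ha⟩ := hAne
    have h := hroot _ (hTS x hx a ha)
    refine ⟨fun h0 ↦ h.1 (by rw [h0, zero_pow (hA a ha).1.ne_zero]), fun m hm h1 ↦ h.2 m hm ?_⟩
    rw [pow_right_comm, h1, one_pow]
  have hmult : ∀ x ∈ T, ∀ a ∈ A, (q.roots.count x : ℝ) ≤ p.roots.count (x ^ a) := by
    intro x hx a ha
    rw [count_roots, count_roots,
      ← rootMultiplicity_comp_X_pow hp0 (hA a ha).1.pos (hT x hx).1]
    exact_mod_cast rootMultiplicity_le_rootMultiplicity_of_dvd (hcomp0 a ha) (hcomp a ha) x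
  have hScard : S.card ≤ n :=
    (Multiset.toFinset_card_le _).trans ((card_roots' p).trans (by rwa [hp, natDegree_map]))
  have hgraph := card_mul_sum_le_of_pow_mem (fun p hp ↦ (hA p hp).1) hℓ hn hnA hScard
    (fun x hx ↦ pow_injective_of_not_torsion (hT x hx).1 (hT x hx).2) hTS
  have hM0 : (0 : ℝ) < M := by positivity
  have hdegree := hgraph (fun x ↦ q.roots.count x) (fun s ↦ p.roots.count s)
    (fun _ _ ↦ Nat.cast_nonneg _) (fun _ _ ↦ Nat.cast_nonneg _) hmult
  have hheight := hgraph (fun x ↦ q.roots.count x * logHeight₁ x)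
    (fun s ↦ p.roots.count s * (2 / M * logHeight₁ s))
    (fun x _ ↦ mul_nonneg (Nat.cast_nonneg _) (zero_le_logHeight₁ x))
    (fun s _ ↦ mul_nonneg (Nat.cast_nonneg _)
      (mul_nonneg (by positivity) (zero_le_logHeight₁ s))) fun x hx a ha ↦ by
        refine mul_le_mul (hmult x hx a ha) ?_ (zero_le_logHeight₁ x) (Nat.cast_nonneg _)
        rw [logHeight₁_pow, ← mul_assoc]
        refine le_mul_of_one_le_left (zero_le_logHeight₁ x) ?_
        have := (hA a ha).2
        rw [div_mul_eq_mul_div, le_div_iff₀ hM0]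
        linarith
  have hsum : ∀ (f : L[X]), f.Splits → ∑ x ∈ f.roots.toFinset, (f.roots.count x : ℝ) = f.natDegree :=
    fun f hf ↦ by
      rw [← Nat.cast_sum, Multiset.toFinset_sum_count_eq, hf.natDegree_eq_card_roots]
  rw [hsum q hQs, hsum p hPs, hq, hp, natDegree_map, natDegree_map] at hdegree
  refine ⟨hdegree, ?_⟩
  have hsumH : ∀ (f : L[X]), ∑ x ∈ f.roots.toFinset, (f.roots.count x : ℝ) * logHeight₁ x =
      (f.roots.map logHeight₁).sum := fun f ↦ by
    rw [Finset.sum_multiset_map_count]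
    simp only [nsmul_eq_mul]
  have hheight' : (A.card : ℝ) * (q.roots.map logHeight₁).sum ≤
      6 * ℓ * (2 / M * (p.roots.map logHeight₁).sum) := by
    rw [← hsumH, ← hsumH, Finset.mul_sum (a := (2 / M : ℝ))]
    refine hheight.trans_eq (congrArg _ (Finset.sum_congr rfl fun s _ ↦ ?_))
    ring
  have h1 := abs_le.mp (abs_log_mulHeight_sub_sum_logHeight₁_le hp0 hPs)
  have h2 := abs_le.mp (abs_log_mulHeight_sub_sum_logHeight₁_le hq0 hQs)
  rw [← finrank_mul_log_polyHeight, natDegree_map] at h1 h2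
  set d : ℝ := (finrank ℚ L : ℝ)
  have hd0 : 0 < d := Nat.cast_pos.mpr finrank_pos
  set hPl := Real.log (polyHeight P)
  set hQl := Real.log (polyHeight Q)
  set sP := (p.roots.map logHeight₁).sum
  set sQ := (q.roots.map logHeight₁).sum
  have hlog : Real.log 2 ≤ 1 := Real.log_two_lt_d9.le.trans (by norm_num)
  have hM2 : (2 : ℝ) ≤ M := by exact_mod_cast hM
  have h3 : sP ≤ d * (hPl + P.natDegree) := by
    have : d * P.natDegree * Real.log 2 ≤ d * P.natDegree * 1 := by gcongr
    linarith [h1.1]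
  have h4 : d * hQl ≤ sQ + d * Q.natDegree := by
    have : d * Q.natDegree * Real.log 2 ≤ d * Q.natDegree * 1 := by gcongr
    linarith [h2.2]
  have h5 : (A.card : ℝ) * M * sQ ≤ 12 * ℓ * sP := by
    have := mul_le_mul_of_nonneg_left hheight' hM0.le
    have h : (M : ℝ) * (6 * ℓ * (2 / M * sP)) = 12 * ℓ * sP := by field_simp; ring
    linarith
  refine le_of_mul_le_mul_left ?_ hd0
  calc d * ((A.card : ℝ) * M * hQl) = (A.card : ℝ) * M * (d * hQl) := by ring
    _ ≤ (A.card : ℝ) * M * (sQ + d * Q.natDegree) := by gcongr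
    _ = (A.card : ℝ) * M * sQ + d * M * (A.card * Q.natDegree) := by ring
    _ ≤ 12 * ℓ * sP + d * M * (6 * ℓ * P.natDegree) := by gcongr
    _ ≤ 12 * ℓ * (d * (hPl + P.natDegree)) + d * M * (6 * ℓ * P.natDegree) := by gcongr
    _ = d * (12 * ℓ * (hPl + M / 2 * P.natDegree + P.natDegree)) := by ring
    _ ≤ d * (12 * ℓ * (M * P.natDegree + hPl)) := by
      have : (2 : ℝ) * P.natDegree ≤ M * P.natDegree := by gcongr
      refine mul_le_mul_of_nonneg_left (mul_le_mul_of_nonneg_left ?_ (by positivity)) hd0.le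
      linarith

theorem theorem7p1 {K : Type*} [Field K] [NumberField K] (M n : ℕ) (hM : 2 ≤ M) (hn : 1 ≤ n)
    (A : Finset ℕ) (hAne : A.Nonempty)
    (hA : ∀ p ∈ A, p.Prime ∧ (M : ℝ) / 2 ≤ (p : ℝ) ∧ p ≤ M)
    (P : K[X]) (hP : P ≠ 0) (hdeg : P.natDegree ≤ n)
    (hroots : ∀ x : AlgebraicClosure K, aeval x P = 0 → x ≠ 0 ∧ ∀ m : ℕ, 0 < m → x ^ m ≠ 1)
    (Q : K[X]) (hQ : IsGcdOfPowers A P Q)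
    (ℓ : ℕ) (hℓ : 4 ≤ 2 * ℓ) (hℓA : 2 * ℓ ≤ A.card)
    (hnA : (n : ℝ) ≤ 1 / (2 ^ (ℓ + 1) * ((ℓ + 1).factorial : ℝ)) * (A.card.choose (ℓ + 2) : ℝ)) :
    (Q.natDegree : ℝ) ≤ 6 * (ℓ : ℝ) / (A.card : ℝ) * (P.natDegree : ℝ) ∧
      Real.log (polyHeight Q) ≤
        (ℓ : ℝ) * 2 ^ (2 * ℓ + 6) / ((A.card : ℝ) * (M : ℝ)) *
          ((M : ℝ) * (P.natDegree : ℝ) + Real.log (polyHeight P)) := by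
  have hQ0 : Q ≠ 0 := by
    obtain ⟨a, ha⟩ := hAne
    refine ne_zero_of_dvd_ne_zero (fun h ↦ hP ?_) (hQ.1 a ha)
    rwa [← expand_eq_comp_X_pow, expand_eq_zero (hA a ha).1.pos] at h
  have hPQ : P * Q ≠ 0 := mul_ne_zero hP hQ0
  let L := (P * Q).SplittingField
  have : NumberField L := NumberField.of_module_finite K L
  have hs : ((P * Q).map (algebraMap K L)).Splits := SplittingField.splits (P * Q)
  have hne : (P * Q).map (algebraMap K L) ≠ 0 :=
    (Polynomial.map_ne_zero_iff (algebraMap K L).injective).mpr hPQ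
  have hPs : (P.map (algebraMap K L)).Splits :=
    hs.of_dvd hne (Polynomial.map_dvd _ (dvd_mul_right P Q))
  have hQs : (Q.map (algebraMap K L)).Splits :=
    hs.of_dvd hne (Polynomial.map_dvd _ (dvd_mul_left Q P))
  let φ : L →ₐ[K] AlgebraicClosure K := IsAlgClosed.lift
  have hrootsL : ∀ x : L, aeval x P = 0 → x ≠ 0 ∧ ∀ m : ℕ, 0 < m → x ^ m ≠ 1 := by
    intro x hx
    have h := hroots (φ x) (by rw [aeval_algHom_apply, hx, map_zero])
    exact ⟨fun h0 ↦ h.1 (by rw [h0, map_zero]),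
      fun m hm h1 ↦ h.2 m hm (by rw [← map_pow, h1, map_one])⟩
  have hnA' : 2 ^ (ℓ + 1) * (ℓ + 1).factorial * n ≤ A.card.choose (ℓ + 2) := by
    have hpos : (0 : ℝ) < 2 ^ (ℓ + 1) * ((ℓ + 1).factorial : ℝ) := by positivity
    rw [one_div, inv_mul_eq_div, le_div_iff₀ hpos, mul_comm] at hnA
    exact_mod_cast hnA
  obtain ⟨h1, h2⟩ := natDegree_le_and_log_polyHeight_le_of_splits (L := L) hM hn hAne
    (fun p hp ↦ ⟨(hA p hp).1, (hA p hp).2.1⟩) hP hdeg hPs hQs hrootsL hQ.1 (by omega) hnA'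
  have hA0 : (0 : ℝ) < A.card := Nat.cast_pos.mpr hAne.card_pos
  have hM0 : (0 : ℝ) < M := by positivity
  constructor
  · rw [div_mul_eq_mul_div, le_div_iff₀ hA0, mul_comm]
    exact h1
  · rw [div_mul_eq_mul_div, le_div_iff₀ (by positivity), mul_comm]
    refine h2.trans ?_
    have hP0 := log_polyHeight_nonneg P
    have h12 : (12 : ℝ) ≤ 2 ^ (2 * ℓ + 6) :=
      le_trans (by norm_num) (pow_le_pow_right₀ one_le_two (show 6 ≤ 2 * ℓ + 6 by omega))
    rw [mul_comm (12 : ℝ)]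
    gcongr
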